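/- Let $a=\begin{pmatrix}0&1\\-1&0\end{pmatrix}$ and $b=\begin{pmatrix}1&-1\\1&0\end{pmatrix}$, regarded as elements of $\mathrm{PSL}_2(\mathbb Z)=\langle a,b\mid a^2=b^3=1\rangle=\mathbb Z/2*\mathbb Z/3$. Every $g\in\mathrm{PSL}_2(\mathbb Z)$ is spelled by exactly one reduced word in the letters $a,b,b^{-1}$ (a word in which, of any two adjacent letters, exactly one is $a$), its canonical word. The Rademacher function is $\mathfrak R(g)=\#_b(g)-\#_{b^{-1}}(g)$, where $\#_{b^{\pm1}}(g)$ is the number of occurrences of $b^{\pm1}$ in the canonical word of $g$. Let $g_1,g_2,\dots$ be independent random elements, each distributed according to the uniform probability measure on $\{ba,ab\}$, and let $w_n=g_1g_2\cdots g_n$. Then each $\mathfrak R(w_n)$ is integrable and $$\lim_{n\to\infty}\mathbb E\left(\frac{\mathfrak R(w_n)}{n}\right)=\frac{7-3\sqrt5}{4}.$$ Moreover, in the Cayley graph of $\mathrm{PSL}_2(\mathbb Z)$ with respect to $\{a,b,b^{-1}\}$, whose geodesics starting at the identity are the paths that spell reduced words and whose Gromov boundary is therefore the set of infinite reduced words,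 the sequence $(w_n)$ converges almost surely to a boundary point. If $\nu$ is the law of the limit (the hitting measure) and $G_{g*}$ is the set of geodesics from the identity that begin with the canonical word of $g$, then $$\nu(G_{a*})=\frac12,\qquad \nu(G_{b*})=\frac{\sqrt5-1}{4},\qquad \nu(G_{b^{-1}*})=\frac{3-\sqrt5}{4}.$$ -/

import Mathlib

open MeasureTheory ProbabilityTheory Filter
open scoped Topology ENNReal

/-- The modular group `PSL₂(ℤ)`. -/
abbrev PSL2Z : Type := Matrix.ProjectiveSpecialLinearGroup (Fin 2) ℤ

instance PSL2Z.instMeasurableSpace : MeasurableSpace PSL2Z := ⊤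

instance PSL2Z.instDiscreteMeasurableSpace : DiscreteMeasurableSpace PSL2Z :=
  ⟨fun _ => trivial⟩

namespace PSL2Z

/-- The matrix `(0 1; -1 0)`. -/
def matA : Matrix.SpecialLinearGroup (Fin 2) ℤ :=
  ⟨!![0, 1; -1, 0], by simp [Matrix.det_fin_two]⟩

/-- The matrix `(1 -1; 1 0)`. -/
def matB : Matrix.SpecialLinearGroup (Fin 2) ℤ :=
  ⟨!![1, -1; 1, 0], by simp [Matrix.det_fin_two]⟩

/-- The element of order two `a ∈ PSL₂(ℤ)`. -/
def a : PSL2Z := QuotientGroup.mk matA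

/-- The element of order three `b ∈ PSL₂(ℤ)`. -/
def b : PSL2Z := QuotientGroup.mk matB

/-- The three letters `a`, `b` and `B = b⁻¹`. -/
inductive Letter : Type
  | a
  | b
  | B
  deriving DecidableEq

namespace Letter

/-- The element of `PSL₂(ℤ)` that a letter stands for. -/
def toPSL : Letter → PSL2Z
  | .a => PSL2Z.a
  | .b => PSL2Z.b
  | .B => PSL2Z.b⁻¹

instance instMeasurableSpace : MeasurableSpace Letter := ⊤

end Letter

/-- Two letters may be adjacent in a reduced word exactly if one of them is `a` and the other one
is `b` or `B`. -/
def Adjacent (x y : Letter) : Prop := x = Letter.a ↔ y ≠ Letter.a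

/-- Reduced words in the letters `a`, `b`, `B`. -/
def Reduced (l : List Letter) : Prop := l.IsChain Adjacent

/-- The element of `PSL₂(ℤ)` that a word spells. -/
def wordEval (l : List Letter) : PSL2Z := (l.map Letter.toPSL).prod

/-! ### Every element is spelled by exactly one reduced word -/

lemma mk_eq_one_iff (A : Matrix.SpecialLinearGroup (Fin 2) ℤ) :
    (QuotientGroup.mk A : PSL2Z) = 1 ↔ A = 1 ∨ A = -1 := by
  rw [QuotientGroup.eq_one_iff, Matrix.SpecialLinearGroup.mem_center_iff]
  constructor
  · rintro ⟨r, hr, h⟩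
    have hr' : r ^ 2 = 1 := by simpa using hr
    rcases (by simpa using hr' : r = 1 ∨ r = -1) with rfl | rfl
    · left; ext i j; rw [← h]; simp
    · right; ext i j; rw [← h]; fin_cases i <;> fin_cases j <;> simp
  · rintro (rfl | rfl)
    · exact ⟨1, by simp, by simp⟩
    · refine ⟨-1, by simp, ?_⟩
      ext i j; fin_cases i <;> fin_cases j <;> simp

lemma a_mul_a : a * a = 1 := by
  change (QuotientGroup.mk (matA * matA) : PSL2Z) = 1
  rw [mk_eq_one_iff]
  right; decide

lemma b_mul_b_mul_b : b * b * b = 1 := by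
  change (QuotientGroup.mk (matB * matB * matB) : PSL2Z) = 1
  rw [mk_eq_one_iff]
  right; decide

lemma b_mul_b : b * b = b⁻¹ := eq_inv_of_mul_eq_one_left b_mul_b_mul_b

lemma binv_mul_binv : b⁻¹ * b⁻¹ = b := by
  rw [← mul_inv_rev, b_mul_b, inv_inv]

namespace Letter

/-- The matrix of a letter. -/
def toSL : Letter → Matrix.SpecialLinearGroup (Fin 2) ℤ
  | .a => matA
  | .b => matB
  | .B => matB⁻¹

/-- Left multiplication of a reduced word by a letter. -/
def act : Letter → List Letter → List Letter
  | .a, .a :: t => t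
  | .a, l => .a :: l
  | .b, .b :: t => .B :: t
  | .b, .B :: t => t
  | .b, l => .b :: l
  | .B, .B :: t => .b :: t
  | .B, .b :: t => t
  | .B, l => .B :: l

/-- The inverse letter. -/
def inv : Letter → Letter
  | .a => .a
  | .b => .B
  | .B => .b

/-- The ping-pong table. -/
def Dom : Letter → (Fin 2 → ℤ) → Prop
  | .a, v => v 0 * v 1 < 0
  | .b, v => 0 < v 0 * v 1 ∧ v 1 ^ 2 < v 0 ^ 2
  | .B, v => 0 < v 0 * v 1 ∧ v 0 ^ 2 < v 1 ^ 2

lemma dom_neg (x : Letter) (v : Fin 2 → ℤ) : Dom x (-v) ↔ Dom x v := by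
  cases x <;> simp [Dom]

lemma dom_unique {x y : Letter} {v : Fin 2 → ℤ} (hx : Dom x v) (hy : Dom y v) : x = y := by
  cases x <;> cases y <;> simp only [Dom] at hx hy <;> first | rfl | omega

lemma exists_dom (x : Letter) : ∃ v, Dom x v := by
  cases x
  · exact ⟨![1, -1], by simp [Dom]⟩
  · exact ⟨![2, 1], by simp [Dom]⟩
  · exact ⟨![1, 2], by simp [Dom]⟩

lemma coe_matB_inv : ((matB⁻¹ : Matrix.SpecialLinearGroup (Fin 2) ℤ) :
    Matrix (Fin 2) (Fin 2) ℤ) = !![0, 1; -1, 1] := by decide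

lemma dom_step {x y : Letter} (h : Adjacent x y) {v : Fin 2 → ℤ} (hv : Dom y v) :
    Dom x ((toSL x).1.mulVec v) := by
  cases x <;> cases y <;> simp [Adjacent] at h <;>
    simp only [toSL, coe_matB_inv] <;>
    simp [Dom, matA, matB, Matrix.mulVec, dotProduct, Fin.sum_univ_two] at hv ⊢ <;>
    (try constructor) <;> nlinarith [sq_nonneg (v 0), sq_nonneg (v 1)]

lemma mk_toSL (x : Letter) : (QuotientGroup.mk (toSL x) : PSL2Z) = x.toPSL := by
  cases x <;> rfl

end Letter

open Letter

lemma wordEval_cons (x : Letter) (l : List Letter) :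
    wordEval (x :: l) = x.toPSL * wordEval l := by simp [wordEval]

lemma wordEval_eq_mk (l : List Letter) :
    wordEval l = (QuotientGroup.mk (l.map toSL).prod : PSL2Z) := by
  induction l with
  | nil => rfl
  | cons x l ih => rw [wordEval_cons, ih, ← mk_toSL]; simp

lemma dom_word (l : List Letter) (k : Letter) (h : Reduced (l ++ [k])) (v : Fin 2 → ℤ)
    (hv : Dom k v) :
    ∃ x, (l ++ [k]).head? = some x ∧ Dom x ((l.map toSL).prod.1.mulVec v) := by
  induction l with
  | nil => exact ⟨k, by simp, by simpa using hv⟩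
  | cons y l ih =>
    have h' : (∀ z ∈ (l ++ [k]).head?, Adjacent y z) ∧ Reduced (l ++ [k]) := by
      simpa [Reduced, List.isChain_cons] using h
    obtain ⟨x, hx, hd⟩ := ih h'.2
    refine ⟨y, by simp, ?_⟩
    have := dom_step (h'.1 x hx) hd
    rw [Matrix.mulVec_mulVec] at this
    rw [List.map_cons, List.prod_cons]
    exact this

lemma wordEval_ne_one_aux (h : Letter) (t : List Letter) (k : Letter)
    (hr : Reduced (h :: t ++ [k])) (hk : k ≠ h) : wordEval (h :: t) ≠ 1 := by
  intro he
  rw [wordEval_eq_mk, mk_eq_one_iff] at he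
  obtain ⟨v, hv⟩ := exists_dom k
  obtain ⟨x, hx, hd⟩ := dom_word (h :: t) k hr v hv
  have hx' : h = x := by simpa using hx
  subst hx'
  rcases he with he | he <;> rw [he] at hd
  · exact hk (dom_unique hv (by simpa using hd))
  · refine hk (dom_unique hv ((dom_neg _ _).mp ?_))
    simpa [Matrix.neg_mulVec] using hd

lemma wordEval_append (l m : List Letter) : wordEval (l ++ m) = wordEval l * wordEval m := by
  simp [wordEval]

lemma reduced_append_singleton {l : List Letter} {k m : Letter} (h : Reduced (l ++ [k]))
    (hm : Adjacent k m) : Reduced (l ++ [k] ++ [m]) := by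
  unfold Reduced at *
  rw [List.isChain_append]
  refine ⟨h, by simp, ?_⟩
  simpa using hm

lemma wordEval_ne_one_of_end_a (l : List Letter) (h : Reduced (l ++ [Letter.a])) :
    wordEval (l ++ [Letter.a]) ≠ 1 := by
  cases l with
  | nil =>
    exact wordEval_ne_one_aux Letter.a [] Letter.b
      (by simp [Reduced, Adjacent]) (by simp)
  | cons x l =>
    by_cases hx : x = Letter.b
    · exact wordEval_ne_one_aux x (l ++ [Letter.a]) Letter.B
        (reduced_append_singleton h (by simp [Adjacent])) (by simp [hx])
    · exact wordEval_ne_one_aux x (l ++ [Letter.a]) Letter.b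
        (reduced_append_singleton h (by simp [Adjacent])) (fun h => hx h.symm)

lemma wordEval_ne_one (l : List Letter) (h : Reduced l) (hl : l ≠ []) : wordEval l ≠ 1 := by
  rcases List.eq_nil_or_concat l with rfl | ⟨t, m, rfl⟩
  · exact absurd rfl hl
  rw [List.concat_eq_append] at *
  by_cases hm : m = Letter.a
  · subst hm; exact wordEval_ne_one_of_end_a t h
  have hma : Adjacent m Letter.a := by simp [Adjacent, hm]
  have hr := reduced_append_singleton h hma
  cases t with
  | nil => exact wordEval_ne_one_aux m [] Letter.a hr (fun h => hm h.symm)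
  | cons x t =>
    by_cases hx : x = Letter.a
    · subst hx
      intro he
      refine wordEval_ne_one_of_end_a (t ++ [m]) ?_ ?_
      · exact List.IsChain.tail hr
      · have h1 : wordEval (t ++ [m]) = a := by
          have h2 : a * wordEval (t ++ [m]) = 1 := by
            rw [← he]; exact (wordEval_cons Letter.a _).symm
          calc wordEval (t ++ [m]) = a * (a * wordEval (t ++ [m])) := by
                rw [← mul_assoc, a_mul_a, one_mul]
            _ = a := by rw [h2, mul_one]
        rw [wordEval_append, h1]
        simpa [wordEval, toPSL] using a_mul_a
    · exact wordEval_ne_one_aux x (t ++ [m]) Letter.a hr (fun h => hx h.symm)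

lemma reduced_act (x : Letter) (l : List Letter) (h : Reduced l) : Reduced (x.act l) := by
  unfold Reduced at *
  rcases l with _ | ⟨y, _ | ⟨z, l⟩⟩
  · cases x <;> simp_all [act]
  · cases x <;> cases y <;> simp_all [act, Adjacent]
  cases x <;> cases y <;> cases z <;> simp_all [act, Adjacent]

lemma wordEval_act (x : Letter) (l : List Letter) :
    wordEval (x.act l) = x.toPSL * wordEval l := by
  rcases l with _ | ⟨y, l⟩ <;> cases x <;> try cases y
  all_goals
    simp [act, wordEval_cons, toPSL, ← mul_assoc, a_mul_a, b_mul_b, binv_mul_binv]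

lemma act_act_inv (x : Letter) (l : List Letter) (h : Reduced l) :
    x.act (x.inv.act l) = l := by
  unfold Reduced at *
  rcases l with _ | ⟨y, _ | ⟨z, l⟩⟩
  · cases x <;> simp_all [act, Letter.inv]
  · cases x <;> cases y <;> simp_all [act, Letter.inv]
  cases x <;> cases y <;> cases z <;> simp_all [act, Letter.inv, Adjacent]

lemma act_eq_cons (x : Letter) (l : List Letter) (h : Reduced (x :: l)) :
    x.act l = x :: l := by
  unfold Reduced at *
  rcases l with _ | ⟨y, l⟩ <;> cases x <;> try cases y
  all_goals simp_all [act, Adjacent]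

lemma toPSL_inv (x : Letter) : x.inv.toPSL = x.toPSL⁻¹ := by
  cases x
  · exact eq_inv_of_mul_eq_one_left a_mul_a
  · rfl
  · simp [Letter.inv, toPSL]

lemma reduced_unique (l l' : List Letter) (h : Reduced l) (h' : Reduced l')
    (he : wordEval l = wordEval l') : l = l' := by
  induction l generalizing l' with
  | nil =>
    by_contra hne
    exact wordEval_ne_one l' h' (fun h => hne h.symm) he.symm
  | cons x t ih =>
    have ht : Reduced t := List.IsChain.tail h
    have h1 := ih (x.inv.act l') ht (reduced_act _ _ h') (by
      rw [wordEval_act, ← he, wordEval_cons, toPSL_inv, inv_mul_cancel_left])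
    rw [← act_eq_cons x t h, h1, act_act_inv x l' h']

lemma exists_reduced (g : PSL2Z) : ∃ l, Reduced l ∧ wordEval l = g := by
  let Q : PSL2Z → Prop := fun g => ∀ l, Reduced l → ∃ l', Reduced l' ∧ wordEval l' = g * wordEval l
  have hQx (x : Letter) : Q x.toPSL := fun l hl => ⟨x.act l, reduced_act x l hl, wordEval_act x l⟩
  have hmul {g h : PSL2Z} (hg : Q g) (hh : Q h) : Q (g * h) := fun l hl => by
    obtain ⟨l₁, h₁, e₁⟩ := hh l hl
    obtain ⟨l₂, h₂, e₂⟩ := hg l₁ h₁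
    exact ⟨l₂, h₂, by rw [e₂, e₁, mul_assoc]⟩
  have ha : Q a := hQx Letter.a
  have hb : Q b := hQx Letter.b
  have hB : Q b⁻¹ := hQx Letter.B
  have hainv : a⁻¹ = a := (eq_inv_of_mul_eq_one_left a_mul_a).symm
  have hS : ModularGroup.S = matA⁻¹ := by decide
  have hT : ModularGroup.T = matB * matA := by decide
  have hmkS : (QuotientGroup.mk ModularGroup.S : PSL2Z) = a := by
    rw [hS]; exact hainv
  have hmkT : (QuotientGroup.mk ModularGroup.T : PSL2Z) = b * a := by
    rw [hT]; rfl
  have key : ∀ A : Matrix.SpecialLinearGroup (Fin 2) ℤ,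
      Q (QuotientGroup.mk A) ∧ Q (QuotientGroup.mk A)⁻¹ := by
    intro A
    have hA : A ∈ Subgroup.closure {ModularGroup.S, ModularGroup.T} := by
      rw [SpecialLinearGroup.SL2Z_generators]; trivial
    induction hA using Subgroup.closure_induction with
    | mem x hx =>
      rcases hx with rfl | rfl
      · rw [hmkS, hainv]; exact ⟨ha, ha⟩
      · rw [hmkT, mul_inv_rev, hainv]; exact ⟨hmul hb ha, hmul ha hB⟩
    | one =>
      have : Q 1 := fun l hl => ⟨l, hl, by rw [one_mul]⟩
      exact ⟨this, by simpa using this⟩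
    | mul x y _ _ hx hy =>
      rw [QuotientGroup.mk_mul, mul_inv_rev]
      exact ⟨hmul hx.1 hy.1, hmul hy.2 hx.2⟩
    | inv x _ hx =>
      rw [QuotientGroup.mk_inv, inv_inv]
      exact ⟨hx.2, hx.1⟩
  obtain ⟨A, rfl⟩ := QuotientGroup.mk_surjective g
  obtain ⟨l, hl, he⟩ := (key A).1 [] (by simp [Reduced])
  exact ⟨l, hl, by rw [he]; exact mul_one _⟩

theorem existsUnique_reduced (g : PSL2Z) : ∃! l : List Letter, Reduced l ∧ wordEval l = g := by
  obtain ⟨l, hl, he⟩ := exists_reduced g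
  exact ⟨l, ⟨hl, he⟩, fun m hm => reduced_unique m l hm.1 hl (hm.2.trans he.symm)⟩

/-- The canonical word of `g`: the unique reduced word in `a`, `b`, `B` that spells `g`. -/
noncomputable def canonicalWord (g : PSL2Z) : List Letter :=
  (existsUnique_reduced g).choose

lemma canonicalWord_spec (g : PSL2Z) :
    Reduced (canonicalWord g) ∧ wordEval (canonicalWord g) = g :=
  (existsUnique_reduced g).choose_spec.1

lemma canonicalWord_wordEval (l : List Letter) (h : Reduced l) :
    canonicalWord (wordEval l) = l :=
  reduced_unique _ _ (canonicalWord_spec _).1 h (canonicalWord_spec _).2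

/-- The Rademacher function: the number of letters `b` minus the number of letters `b⁻¹` in the
canonical word. -/
noncomputable def rademacher (g : PSL2Z) : ℤ :=
  ((canonicalWord g).count Letter.b : ℤ) - ((canonicalWord g).count Letter.B : ℤ)

/-! ### The random walk -/

/-- The uniform probability measure on `{ba, ab}`. -/
noncomputable def stepMeasure : Measure PSL2Z :=
  (2⁻¹ : ℝ≥0∞) • Measure.dirac (b * a) + (2⁻¹ : ℝ≥0∞) • Measure.dirac (a * b)

/-- The position after `n` steps, `w_n = g_1 ⋯ g_n`; the increment `g_i` is `g (i - 1)` here. -/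
def walk {Ω : Type*} (g : ℕ → Ω → PSL2Z) : ℕ → Ω → PSL2Z
  | 0, _ => 1
  | n + 1, ω => walk g n ω * g n ω

/-! ### The Gromov boundary -/

/-- The Gromov boundary of `PSL₂(ℤ)`. In the Cayley graph for the generators `a`, `b`, `b⁻¹`
(a tree of triangles) the geodesics from the identity are exactly the paths that spell reduced
words, and distinct rays from the identity are not at bounded distance. So boundary points are the
infinite reduced words. -/
def Boundary : Type := {ξ : ℕ → Letter // ∀ i, Adjacent (ξ i) (ξ (i + 1))}

instance Boundary.instMeasurableSpace : MeasurableSpace Boundary :=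
  inferInstanceAs (MeasurableSpace {ξ : ℕ → Letter // ∀ i, Adjacent (ξ i) (ξ (i + 1))})

/-- The initial word of length `k` of a boundary point. -/
def Boundary.initial (ξ : Boundary) (k : ℕ) : List Letter := (List.range k).map ξ.1

/-- The boundary part of the cylinder `G_{g*}`: the infinite geodesics from the identity that begin
with the canonical word of `g`. -/
def cylinder (g : PSL2Z) : Set Boundary :=
  {ξ | ξ.initial (canonicalWord g).length = canonicalWord g}

/-- Convergence of a sequence in the group to a boundary point: for every `k`, the geodesics from
the identity to `u n` eventually begin with the first `k` letters of `ξ`. -/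
def ConvergesTo (u : ℕ → PSL2Z) (ξ : Boundary) : Prop :=
  ∀ k : ℕ, ∀ᶠ n in atTop, ξ.initial k <+: canonicalWord (u n)

end PSL2Z

namespace PSL2Z

/-! ### Right multiplication on reversed canonical words -/

/-! Write q for `popProb` and give each b weight 2 and each b⁻¹ weight 1. Whatever the last letter
of a word of positive height, one of the two steps appends a new b (height +2), while the other
multiplies the last b^{±1} by b, turning b into b⁻¹ or deleting b⁻¹ (height −1). At height 0, that
is at 1 or a, both steps give +2. The height is thus a walk with equally likely jumps +2 and −1,
reflected at 0; it drifts to infinity.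

Drift: at positive height the signed count grows on average by 1 when the last b^{±1} is b⁻¹ and by
−1/2 when it is b. The bounded `corrector` c solves the Poisson equation whose mean increment is q
minus the indicator that this letter is b. Hence signed count − (3/2)c has the constant mean
increment 1 − 3q/2 = (7 − 3√5)/4, except at height 0 (`avg_drift`). The expected number of visits
there is finite because (4/5)^height decays geometrically in mean (`avg_pow_height_le`), so dividing
by n leaves the constant.

Boundary: a step alters at most the last two letters, so growing height freezes every initial
letter. The hitting probabilities are values at the identity of the harmonic functions `startA` and
`startB`, which tend along the walk to the indicator of the first letter
(`map_limitPoint_real_cylinder_of_harmonic`). -/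

lemma adjacent_comm {x y : Letter} : Adjacent x y ↔ Adjacent y x := by
  cases x <;> cases y <;> simp [Adjacent]

lemma Reduced.reverse {l : List Letter} (h : Reduced l) : Reduced l.reverse := by
  unfold Reduced at *
  rw [List.isChain_reverse]
  exact h.imp fun x y => adjacent_comm.mp

/-- On reversed words the left action `act` becomes right multiplication, so a step of the walk
works at the head of a list, as on a stack. -/
lemma wordEval_reverse_act (x : Letter) (l : List Letter) :
    wordEval (x.act l).reverse = wordEval l.reverse * x.toPSL := by
  rcases l with _ | ⟨y, l⟩ <;> cases x <;> try cases y
  all_goals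
    simp [Letter.act, wordEval, Letter.toPSL, mul_assoc, a_mul_a, b_mul_b, binv_mul_binv]

/-- The canonical word, read backwards. -/
noncomputable def revWord (g : PSL2Z) : List Letter := (canonicalWord g).reverse

lemma reduced_revWord (g : PSL2Z) : Reduced (revWord g) := (canonicalWord_spec g).1.reverse

lemma canonicalWord_one : canonicalWord 1 = [] :=
  canonicalWord_wordEval [] (by simp [Reduced])

lemma revWord_one : revWord 1 = [] := by rw [revWord, canonicalWord_one]; rfl

lemma revWord_mul_toPSL (g : PSL2Z) (x : Letter) :
    revWord (g * x.toPSL) = x.act (revWord g) := by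
  have h : wordEval (x.act (revWord g)).reverse = g * x.toPSL := by
    rw [wordEval_reverse_act, revWord, List.reverse_reverse, (canonicalWord_spec g).2]
  rw [revWord, ← h, canonicalWord_wordEval _ (reduced_act x _ (reduced_revWord g)).reverse,
    List.reverse_reverse]

lemma revWord_mul_ba (g : PSL2Z) :
    revWord (g * (b * a)) = Letter.a.act (Letter.b.act (revWord g)) := by
  rw [← mul_assoc]
  exact (revWord_mul_toPSL (g * b) Letter.a).trans
    (congrArg _ (revWord_mul_toPSL g Letter.b))

lemma revWord_mul_ab (g : PSL2Z) :
    revWord (g * (a * b)) = Letter.b.act (Letter.a.act (revWord g)) := by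
  rw [← mul_assoc]
  exact (revWord_mul_toPSL (g * a) Letter.b).trans
    (congrArg _ (revWord_mul_toPSL g Letter.a))

lemma drop_one_suffix_act (x : Letter) (l : List Letter) : l.drop 1 <:+ x.act l := by
  rcases l with _ | ⟨y, l⟩ <;> cases x <;> try cases y
  all_goals simp [Letter.act, List.suffix_cons_iff]

/-- A step is two letters, and each can disturb only the current top letter. This locality is what
makes initial letters settle. -/
lemma drop_two_suffix_act_act (x y : Letter) (l : List Letter) :
    l.drop 2 <:+ y.act (x.act l) := by
  obtain ⟨t, ht⟩ := drop_one_suffix_act x l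
  refine List.IsSuffix.trans ?_ (drop_one_suffix_act y _)
  rw [← ht]
  rcases t with _ | ⟨z, t⟩
  · simp
  · have h : l.drop 2 = (l.drop 1).drop 1 := by rw [List.drop_drop]
    rw [h]
    exact (List.drop_suffix 1 _).trans (List.suffix_append t _)

/-! ### Functionals of words -/

/-- The probability `(√5 - 1) / 2` of ever losing one unit of height. -/
noncomputable def popProb : ℝ := (√5 - 1) / 2

lemma popProb_sq : popProb ^ 2 = 1 - popProb := by
  have := Real.sq_sqrt (show (0 : ℝ) ≤ 5 by norm_num)
  unfold popProb; linarith

/-- This is the first-step equation q = (1 + q³)/2: a unit of height is lost at once, or two are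
gained and three must then be lost. -/
lemma popProb_pow_three : popProb ^ 3 = 2 * popProb - 1 := by
  linear_combination (popProb - 1) * popProb_sq

lemma popProb_pos : 0 < popProb := by
  have : (1 : ℝ) < √5 := by rw [Real.lt_sqrt] <;> norm_num
  unfold popProb; linarith

lemma popProb_lt_one : popProb < 1 := by
  nlinarith [popProb_sq, popProb_pos]

/-- The height of a word: `b` counts twice, `b⁻¹` once. -/
def height (l : List Letter) : ℕ := 2 * l.count Letter.b + l.count Letter.B

/-- The corrector of the drift: the discounted number of letters `b`. -/
noncomputable def corrector : List Letter → ℝ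
  | [] => 0
  | .a :: l => corrector l
  | .B :: l => popProb * corrector l
  | .b :: l => 2 * popProb + popProb ^ 2 * corrector l

/-- The number of letters `b` minus the number of letters `b⁻¹`. -/
def signedCount (l : List Letter) : ℝ := (l.count Letter.b : ℝ) - (l.count Letter.B : ℝ)

@[simp] lemma height_nil : height [] = 0 := rfl
@[simp] lemma height_a (l : List Letter) : height (.a :: l) = height l := by simp [height]
@[simp] lemma height_b (l : List Letter) : height (.b :: l) = height l + 2 := by
  simp [height]; ring
@[simp] lemma height_B (l : List Letter) : height (.B :: l) = height l + 1 := by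
  simp [height]; ring
@[simp] lemma signedCount_nil : signedCount [] = 0 := by simp [signedCount]
@[simp] lemma signedCount_a (l : List Letter) : signedCount (.a :: l) = signedCount l := by
  simp [signedCount]
@[simp] lemma signedCount_b (l : List Letter) : signedCount (.b :: l) = signedCount l + 1 := by
  simp [signedCount]; ring
@[simp] lemma signedCount_B (l : List Letter) : signedCount (.B :: l) = signedCount l - 1 := by
  simp [signedCount]; ring

lemma corrector_mem (l : List Letter) : 0 ≤ corrector l ∧ corrector l ≤ 2 := by
  have h0 := popProb_pos
  have h1 := popProb_lt_one
  induction l with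
  | nil => simp [corrector]
  | cons x l ih =>
    obtain ⟨h2, h3⟩ := ih
    cases x <;> simp only [corrector]
    · exact ⟨h2, h3⟩
    · rw [popProb_sq]
      constructor <;> nlinarith
    · constructor <;> nlinarith

lemma rademacher_eq_signedCount (g : PSL2Z) : (rademacher g : ℝ) = signedCount (revWord g) := by
  simp [rademacher, signedCount, revWord]

lemma height_le (l : List Letter) : height l ≤ 2 * l.length := by
  induction l with
  | nil => simp
  | cons x l ih => cases x <;> simp <;> omega

/-- Case analysis on the top of a reduced word. -/
lemma Reduced.cases_top {l : List Letter} (hl : Reduced l) :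
    l = [] ∨ l = [.a] ∨ l = [.b] ∨ l = [.B] ∨ l = [.a, .b] ∨ l = [.a, .B] ∨
      (∃ t, l = .b :: .a :: t) ∨ (∃ t, l = .B :: .a :: t) ∨
      (∃ t, l = .a :: .b :: .a :: t) ∨ (∃ t, l = .a :: .B :: .a :: t) := by
  rcases l with _ | ⟨x, _ | ⟨y, _ | ⟨z, l⟩⟩⟩
  · simp
  · cases x <;> simp
  · cases x <;> cases y <;> simp_all [Reduced, Adjacent]
  · cases x <;> cases y <;> cases z <;> simp_all [Reduced, Adjacent]

/-- The average of `f` over the two possible positions after the next step. -/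
noncomputable def avg (f : List Letter → ℝ) (l : List Letter) : ℝ :=
  (f (Letter.a.act (Letter.b.act l)) + f (Letter.b.act (Letter.a.act l))) / 2

/-- In terms of q the constant is 1 − 3q/2. At height 0 the signed count gains 1 and the corrector
gains 2q instead of q, whence the defect 3q/2. -/
lemma avg_drift (l : List Letter) (hl : Reduced l) :
    avg (fun l => signedCount l - 3 / 2 * corrector l) l =
      signedCount l - 3 / 2 * corrector l + (7 - 3 * √5) / 4
        - (if height l = 0 then 3 / 2 * popProb else 0) := by
  have hs : √5 = 2 * popProb + 1 := by unfold popProb; ring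
  rw [hs]
  have h2 := popProb_sq
  have h3 := popProb_pow_three
  rcases hl.cases_top with rfl | rfl | rfl | rfl | rfl | rfl | ⟨t, rfl⟩ | ⟨t, rfl⟩ | ⟨t, rfl⟩ | ⟨t, rfl⟩ <;>
    simp only [avg, Letter.act, signedCount_nil, signedCount_a, signedCount_b, signedCount_B,
      corrector, height_nil, height_a, height_b, height_B] <;> norm_num <;> grind

/-- At positive height the factor is ((4/5)² + 5/4)/2 = 189/200; at height 0 it is (4/5)². Any base
strictly between q and 1 would also contract. -/
lemma avg_pow_height_le (l : List Letter) (hl : Reduced l) :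
    avg (fun l => (4 / 5 : ℝ) ^ height l) l ≤ 189 / 200 * (4 / 5 : ℝ) ^ height l := by
  rcases hl.cases_top with rfl | rfl | rfl | rfl | rfl | rfl | ⟨t, rfl⟩ | ⟨t, rfl⟩ | ⟨t, rfl⟩ | ⟨t, rfl⟩ <;>
    simp only [avg, Letter.act, height_nil, height_a, height_b, height_B, pow_succ] <;>
    norm_num
  all_goals
    have := pow_pos (show (0 : ℝ) < 4 / 5 by norm_num) (height t)
    linarith

/-- The probability that the limit of the walk from `l` begins with `a`. -/
noncomputable def startA (l : List Letter) : ℝ :=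
  popProb ^ height l / 2 + if l.getLast? = some .a then 1 - popProb ^ height l else 0

/-- The probability that the limit of the walk from `l` begins with `b`. -/
noncomputable def startB (l : List Letter) : ℝ :=
  popProb ^ (height l + 1) / 2 + if l.getLast? = some .b then 1 - popProb ^ (height l - 1) else 0

lemma two_le_height_of_getLast? {l : List Letter} (h : l.getLast? = some .b) :
    2 ≤ height l := by
  have : 0 < l.count Letter.b := List.count_pos_iff.mpr (List.mem_of_getLast? h)
  unfold height; omega

/-- With h the height, the walk reaches height 0 with probability q^h and from there has an even
chance of starting with a; otherwise the present first letter survives. -/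
lemma avg_startA (l : List Letter) (hl : Reduced l) : avg startA l = startA l := by
  have h2 := popProb_sq
  have h3 := popProb_pow_three
  rcases hl.cases_top with rfl | rfl | rfl | rfl | rfl | rfl | ⟨t, rfl⟩ | ⟨t, rfl⟩ | ⟨t, rfl⟩ | ⟨t, rfl⟩ <;>
    try rcases t with _ | ⟨c, t⟩
  all_goals
    simp only [avg, startA, Letter.act, height_nil, height_a, height_b, height_B,
      List.getLast?_cons_cons, List.getLast?_singleton, List.getLast?_nil, pow_succ]
  all_goals grind

/-- From height 0 the chance of ending with first letter b is q/2. An initial b is lost already at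
height 1, where it has become b⁻¹, which explains the exponent h − 1. -/
lemma avg_startB (l : List Letter) (hl : Reduced l) : avg startB l = startB l := by
  have h2 := popProb_sq
  have h3 := popProb_pow_three
  rcases hl.cases_top with rfl | rfl | rfl | rfl | rfl | rfl | ⟨t, rfl⟩ | ⟨t, rfl⟩ | ⟨t, rfl⟩ | ⟨t, rfl⟩ <;>
    try rcases t with _ | ⟨c, t⟩
  all_goals
    simp only [avg, startB, Letter.act, height_nil, height_a, height_b, height_B,
      List.getLast?_cons_cons, List.getLast?_singleton, List.getLast?_nil]
  all_goals try grind
  all_goals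
    -- An initial b forces height at least 2, so the truncated subtraction in the exponent is a true
    -- one.
    by_cases hb : (c :: t).getLast? = some Letter.b
    · obtain ⟨k, hk⟩ := Nat.exists_eq_add_of_le (two_le_height_of_getLast? hb)
      simp only [hb, if_true, hk, Nat.add_sub_cancel, pow_succ, pow_add]
      grind
    · simp only [hb, if_false, pow_succ]
      grind

end PSL2Z

namespace PSL2Z

/-! ### The law of the walk and its one-step recursion -/

/-- Countability makes multiplication jointly measurable for the discrete σ-algebra. -/
instance instCountable : Countable PSL2Z :=
  haveI : Countable (Matrix (Fin 2) (Fin 2) ℤ) :=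
    (inferInstance : Countable (Fin 2 → Fin 2 → ℤ))
  haveI : Countable (Matrix.SpecialLinearGroup (Fin 2) ℤ) :=
    Function.Injective.countable Subtype.val_injective
  QuotientGroup.mk_surjective.countable

lemma walk_congr {Ω Ω' : Type*} {g : ℕ → Ω → PSL2Z} {g' : ℕ → Ω' → PSL2Z} {ω : Ω} {ω' : Ω'}
    (n : ℕ) (h : ∀ i < n, g i ω = g' i ω') : walk g n ω = walk g' n ω' := by
  induction n with
  | zero => rfl
  | succ n ih =>
    simp only [walk]
    rw [ih fun i hi => h i (hi.trans n.lt_succ_self), h n n.lt_succ_self]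

variable {Ω : Type*} [MeasurableSpace Ω] {P : Measure Ω} {g : ℕ → Ω → PSL2Z}

lemma measurable_walk (hmeas : ∀ i, Measurable (g i)) (n : ℕ) : Measurable (walk g n) := by
  induction n with
  | zero => exact measurable_const
  | succ n ih => exact ih.mul (hmeas n)

lemma indepFun_walk [IsProbabilityMeasure P] (hmeas : ∀ i, Measurable (g i))
    (hindep : iIndepFun g P) (n : ℕ) : IndepFun (walk g n) (g n) P := by
  have h := hindep.indepFun_finset (Finset.range n) {n} (by simp) hmeas
  -- Padding a finite tuple by 1 exhibits the walk as a function of the first n increments only.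
  let u : ℕ → (Finset.range n → PSL2Z) → PSL2Z :=
    fun i x => if hi : i ∈ Finset.range n then x ⟨i, hi⟩ else 1
  have hu : ∀ i, Measurable (u i) := fun i => by
    by_cases hi : i ∈ Finset.range n
    · simpa only [u, hi, dif_pos] using measurable_pi_apply _
    · simpa only [u, hi, dif_neg, not_false_eq_true] using measurable_const
  have hw : walk g n = walk u n ∘ fun ω (i : Finset.range n) => g i ω := by
    funext ω
    exact walk_congr n fun i hi => by simp [u, hi]
  rw [hw]
  exact h.comp (measurable_walk hu n)
    (measurable_pi_apply (⟨n, Finset.mem_singleton_self n⟩ : ({n} : Finset ℕ)))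

lemma map_walk_succ [IsProbabilityMeasure P] (hmeas : ∀ i, Measurable (g i))
    (hindep : iIndepFun g P) (hlaw : ∀ i, P.map (g i) = stepMeasure) (n : ℕ) :
    P.map (walk g (n + 1)) = (2⁻¹ : ℝ≥0∞) • (P.map (walk g n)).map (· * (b * a)) +
      (2⁻¹ : ℝ≥0∞) • (P.map (walk g n)).map (· * (a * b)) := by
  have hw := measurable_walk hmeas n
  have := Measure.isProbabilityMeasure_map (μ := P) hw.aemeasurable
  have h1 := (indepFun_walk hmeas hindep n).map_prod_eq_prod_map_map hw.aemeasurable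
    (hmeas n).aemeasurable
  have hm : Measurable fun p : PSL2Z × PSL2Z => p.1 * p.2 := measurable_fst.mul measurable_snd
  have h2 : walk g (n + 1) = (fun p : PSL2Z × PSL2Z => p.1 * p.2) ∘
      fun ω => (walk g n ω, g n ω) := rfl
  rw [h2, ← Measure.map_map hm (hw.prodMk (hmeas n)), h1, hlaw, stepMeasure, Measure.prod_add,
    Measure.prod_smul_right, Measure.prod_smul_right, Measure.prod_dirac, Measure.prod_dirac,
    Measure.map_add _ _ hm, Measure.map_smul, Measure.map_smul,
    Measure.map_map hm (measurable_prodMk_right), Measure.map_map hm (measurable_prodMk_right)]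
  rfl

/-- No bound on `f` is needed: the law of the walk at time n is a finite combination of point
masses. -/
lemma integrable_walk [IsProbabilityMeasure P] (hmeas : ∀ i, Measurable (g i))
    (hindep : iIndepFun g P) (hlaw : ∀ i, P.map (g i) = stepMeasure) (n : ℕ) (f : PSL2Z → ℝ) :
    Integrable (fun ω => f (walk g n ω)) P := by
  have hf (f : PSL2Z → ℝ) (μ : Measure PSL2Z) : AEStronglyMeasurable f μ :=
    (Measurable.of_discrete (f := f)).aestronglyMeasurable
  -- The induction needs all `f` at once, since it is applied to the translates of `f` by the two
  -- steps.
  suffices h : ∀ f : PSL2Z → ℝ, Integrable f (P.map (walk g n)) from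
    (integrable_map_measure (hf _ _) (measurable_walk hmeas n).aemeasurable).mp (h f)
  induction n with
  | zero =>
    intro f
    rw [integrable_map_measure (hf _ _) (measurable_walk hmeas 0).aemeasurable]
    exact integrable_const (f 1)
  | succ n ih =>
    intro f
    rw [map_walk_succ hmeas hindep hlaw]
    refine Integrable.add_measure (Integrable.smul_measure ?_ (by simp))
      (Integrable.smul_measure ?_ (by simp)) <;>
    · rw [integrable_map_measure (hf _ _) Measurable.of_discrete.aemeasurable]
      exact ih _

lemma integral_walk_succ [IsProbabilityMeasure P] (hmeas : ∀ i, Measurable (g i))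
    (hindep : iIndepFun g P) (hlaw : ∀ i, P.map (g i) = stepMeasure) (n : ℕ) (f : PSL2Z → ℝ) :
    ∫ ω, f (walk g (n + 1) ω) ∂P =
      ∫ ω, (f (walk g n ω * (b * a)) + f (walk g n ω * (a * b))) / 2 ∂P := by
  have hf (f : PSL2Z → ℝ) (μ : Measure PSL2Z) : AEStronglyMeasurable f μ :=
    (Measurable.of_discrete (f := f)).aestronglyMeasurable
  have hi (f : PSL2Z → ℝ) : Integrable f (P.map (walk g n)) :=
    (integrable_map_measure (hf _ _) (measurable_walk hmeas n).aemeasurable).mpr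
      (integrable_walk hmeas hindep hlaw n f)
  have hj (x : PSL2Z) : Integrable f ((P.map (walk g n)).map (· * x)) :=
    (integrable_map_measure (hf _ _) Measurable.of_discrete.aemeasurable).mpr (hi _)
  have hI (x : PSL2Z) : ∫ y, f y ∂((P.map (walk g n)).map (· * x)) =
      ∫ ω, f (walk g n ω * x) ∂P := by
    rw [integral_map Measurable.of_discrete.aemeasurable (hf _ _),
      integral_map (measurable_walk hmeas n).aemeasurable (hf _ _)]
  rw [← integral_map (measurable_walk hmeas (n + 1)).aemeasurable (hf f _),
    map_walk_succ hmeas hindep hlaw,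
    integral_add_measure ((hj _).smul_measure (by simp)) ((hj _).smul_measure (by simp)),
    integral_smul_measure, integral_smul_measure, hI, hI, integral_div,
    integral_add (integrable_walk hmeas hindep hlaw n fun y => f (y * (b * a)))
      (integrable_walk hmeas hindep hlaw n fun y => f (y * (a * b)))]
  simp only [ENNReal.toReal_inv, ENNReal.toReal_ofNat, smul_eq_mul]
  ring

end PSL2Z

namespace PSL2Z

variable {Ω : Type*} [MeasurableSpace Ω] {P : Measure Ω} [IsProbabilityMeasure P]
  {g : ℕ → Ω → PSL2Z}

/-! ### Expectations of word functionals along the walk -/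

lemma integral_revWord_succ (hmeas : ∀ i, Measurable (g i)) (hindep : iIndepFun g P)
    (hlaw : ∀ i, P.map (g i) = stepMeasure) (n : ℕ) (f : List Letter → ℝ) :
    ∫ ω, f (revWord (walk g (n + 1) ω)) ∂P = ∫ ω, avg f (revWord (walk g n ω)) ∂P := by
  rw [integral_walk_succ hmeas hindep hlaw n fun x => f (revWord x)]
  simp only [revWord_mul_ba, revWord_mul_ab, avg]

lemma integral_revWord_of_harmonic (hmeas : ∀ i, Measurable (g i)) (hindep : iIndepFun g P)
    (hlaw : ∀ i, P.map (g i) = stepMeasure) {f : List Letter → ℝ}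
    (hf : ∀ l, Reduced l → avg f l = f l) (n : ℕ) :
    ∫ ω, f (revWord (walk g n ω)) ∂P = f [] := by
  induction n with
  | zero => simp [walk, revWord_one]
  | succ n ih =>
    rw [integral_revWord_succ hmeas hindep hlaw, ← ih]
    simp only [hf _ (reduced_revWord _)]

lemma integral_pow_height_le (hmeas : ∀ i, Measurable (g i)) (hindep : iIndepFun g P)
    (hlaw : ∀ i, P.map (g i) = stepMeasure) (n : ℕ) :
    ∫ ω, (4 / 5 : ℝ) ^ height (revWord (walk g n ω)) ∂P ≤ (189 / 200) ^ n := by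
  induction n with
  | zero => simp [walk, revWord_one]
  | succ n ih =>
    rw [integral_revWord_succ hmeas hindep hlaw n fun l => (4 / 5 : ℝ) ^ height l]
    calc _ ≤ ∫ ω, 189 / 200 * (4 / 5 : ℝ) ^ height (revWord (walk g n ω)) ∂P :=
          integral_mono
            (integrable_walk hmeas hindep hlaw n
              fun x => avg (fun l => (4 / 5 : ℝ) ^ height l) (revWord x))
            (integrable_walk hmeas hindep hlaw n
              fun x => 189 / 200 * (4 / 5 : ℝ) ^ height (revWord x))
            fun ω => avg_pow_height_le _ (reduced_revWord _)
      _ ≤ _ := by rw [integral_const_mul, pow_succ']; gcongr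

/-! ### The drift -/

lemma abs_integral_signedCount_sub_le (hmeas : ∀ i, Measurable (g i)) (hindep : iIndepFun g P)
    (hlaw : ∀ i, P.map (g i) = stepMeasure) (n : ℕ) :
    |∫ ω, (signedCount (revWord (walk g n ω)) -
        3 / 2 * corrector (revWord (walk g n ω))) ∂P - n * ((7 - 3 * √5) / 4)| ≤
      3 / 2 * ∑ k ∈ Finset.range n, (189 / 200 : ℝ) ^ k := by
  induction n with
  | zero => simp [walk, revWord_one, corrector]
  | succ n ih =>
    let f : List Letter → ℝ := fun l => signedCount l - 3 / 2 * corrector l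
    let e : List Letter → ℝ := fun l => if height l = 0 then 3 / 2 * popProb else 0
    -- The indicator of height 0 is at most (4/5)^height, so the expected defects are summable.
    have he : ∀ l, 0 ≤ e l ∧ e l ≤ 3 / 2 * (4 / 5 : ℝ) ^ height l := fun l => by
      have h0 := popProb_pos
      have h1 := popProb_lt_one
      by_cases h : height l = 0
      · simp only [e, h, if_true, pow_zero]
        constructor <;> linarith
      · simp only [e, h, if_false]
        exact ⟨le_rfl, by positivity⟩
    have hint (f : List Letter → ℝ) := integrable_walk hmeas hindep hlaw n fun x => f (revWord x)
    have hstep : ∫ ω, f (revWord (walk g (n + 1) ω)) ∂P =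
        ∫ ω, f (revWord (walk g n ω)) ∂P + (7 - 3 * √5) / 4 -
          ∫ ω, e (revWord (walk g n ω)) ∂P := by
      rw [integral_revWord_succ hmeas hindep hlaw]
      have h : ∀ ω, avg f (revWord (walk g n ω)) =
          f (revWord (walk g n ω)) + (7 - 3 * √5) / 4 - e (revWord (walk g n ω)) :=
        fun ω => avg_drift _ (reduced_revWord _)
      simp only [h]
      rw [integral_sub (hint fun l => f l + (7 - 3 * √5) / 4) (hint e),
        integral_add (hint f) (integrable_const _), integral_const]
      simp
    have h0 : 0 ≤ ∫ ω, e (revWord (walk g n ω)) ∂P := integral_nonneg fun ω => (he _).1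
    have h1 : ∫ ω, e (revWord (walk g n ω)) ∂P ≤ 3 / 2 * (189 / 200) ^ n :=
      calc _ ≤ ∫ ω, 3 / 2 * (4 / 5 : ℝ) ^ height (revWord (walk g n ω)) ∂P :=
            integral_mono (hint e) (hint fun l => 3 / 2 * (4 / 5 : ℝ) ^ height l)
              fun ω => (he _).2
        _ ≤ _ := by
          rw [integral_const_mul]
          gcongr
          exact integral_pow_height_le hmeas hindep hlaw n
    change |∫ ω, f (revWord (walk g (n + 1) ω)) ∂P - _| ≤ _
    change |∫ ω, f (revWord (walk g n ω)) ∂P - _| ≤ _ at ih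
    rw [hstep, Finset.sum_range_succ]
    push_cast
    rw [abs_le] at ih ⊢
    constructor <;> linarith

lemma tendsto_integral_rademacher_div (hmeas : ∀ i, Measurable (g i)) (hindep : iIndepFun g P)
    (hlaw : ∀ i, P.map (g i) = stepMeasure) :
    Tendsto (fun n : ℕ => ∫ ω, (rademacher (walk g n ω) : ℝ) / (n : ℝ) ∂P) atTop
      (𝓝 ((7 - 3 * √5) / 4)) := by
  have hgeom (n : ℕ) : ∑ k ∈ Finset.range n, (189 / 200 : ℝ) ^ k ≤ 200 / 11 := by
    refine (Summable.sum_le_tsum _ (fun _ _ => by positivity)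
      (summable_geometric_of_lt_one (by norm_num) (by norm_num))).trans ?_
    rw [tsum_geometric_of_lt_one (by norm_num) (by norm_num)]
    norm_num
  -- The defects contribute at most (3/2)(200/11) and the corrector at most (3/2)·2, together less
  -- than 31.
  have hbound (n : ℕ) :
      |∫ ω, (rademacher (walk g n ω) : ℝ) ∂P - n * ((7 - 3 * √5) / 4)| ≤ 31 := by
    have h := abs_integral_signedCount_sub_le hmeas hindep hlaw n
    have hint (f : List Letter → ℝ) := integrable_walk hmeas hindep hlaw n fun x => f (revWord x)
    rw [integral_sub (hint signedCount) ((hint corrector).const_mul _), integral_const_mul] at h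
    have h0 : 0 ≤ ∫ ω, corrector (revWord (walk g n ω)) ∂P :=
      integral_nonneg fun ω => (corrector_mem _).1
    have h1 : ∫ ω, corrector (revWord (walk g n ω)) ∂P ≤ 2 := by
      have := integral_mono (hint corrector) (integrable_const (2 : ℝ))
        fun ω => (corrector_mem _).2
      simpa using this
    simp only [rademacher_eq_signedCount]
    have := hgeom n
    rw [abs_le] at h ⊢
    constructor <;> linarith
  rw [tendsto_iff_norm_sub_tendsto_zero]
  refine squeeze_zero' (Eventually.of_forall fun _ => norm_nonneg _) ?_
    (tendsto_const_div_atTop_nhds_zero_nat 31)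
  filter_upwards [eventually_gt_atTop 0] with n hn
  have hn' : (0 : ℝ) < n := by exact_mod_cast hn
  rw [integral_div, Real.norm_eq_abs, le_div_iff₀ hn', ← abs_of_pos hn', ← abs_mul,
    abs_of_pos hn', sub_mul, div_mul_cancel₀ _ hn'.ne', mul_comm _ (n : ℝ)]
  exact hbound n

/-! ### Convergence to the boundary -/

/-- Markov's inequality for (4/5)^height bounds the probability of height below K by a geometric
sequence in n, and Borel–Cantelli applies. -/
lemma ae_tendsto_height (hmeas : ∀ i, Measurable (g i)) (hindep : iIndepFun g P)
    (hlaw : ∀ i, P.map (g i) = stepMeasure) :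
    ∀ᵐ ω ∂P, Tendsto (fun n => height (revWord (walk g n ω))) atTop atTop := by
  have hK (K : ℕ) : ∀ᵐ ω ∂P, ∀ᶠ n in atTop, K ≤ height (revWord (walk g n ω)) := by
    have hb (n : ℕ) : P {ω | (4 / 5 : ℝ) ^ K ≤ (4 / 5 : ℝ) ^ height (revWord (walk g n ω))} ≤
        ENNReal.ofReal ((5 / 4) ^ K * (189 / 200) ^ n) := by
      have h1 := mul_meas_ge_le_integral_of_nonneg (μ := P)
        (f := fun ω => (4 / 5 : ℝ) ^ height (revWord (walk g n ω)))
        (Eventually.of_forall fun ω => by positivity)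
        (integrable_walk hmeas hindep hlaw n fun x => (4 / 5 : ℝ) ^ height (revWord x))
        ((4 / 5 : ℝ) ^ K)
      have h2 := h1.trans (integral_pow_height_le hmeas hindep hlaw n)
      rw [← ofReal_measureReal]
      refine ENNReal.ofReal_le_ofReal ?_
      have h3 : (5 / 4 : ℝ) ^ K * (4 / 5) ^ K = 1 := by rw [← mul_pow]; norm_num
      calc _ = (5 / 4 : ℝ) ^ K * ((4 / 5) ^ K *
            P.real {ω | (4 / 5 : ℝ) ^ K ≤ (4 / 5 : ℝ) ^ height (revWord (walk g n ω))}) := by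
            rw [← mul_assoc, h3, one_mul]
        _ ≤ _ := by gcongr
    have hsum : ∑' n, P {ω | (4 / 5 : ℝ) ^ K ≤
        (4 / 5 : ℝ) ^ height (revWord (walk g n ω))} ≠ ∞ :=
      ne_top_of_le_ne_top (Summable.tsum_ofReal_ne_top
        ((summable_geometric_of_lt_one (by norm_num) (by norm_num)).mul_left _))
        (ENNReal.tsum_le_tsum hb)
    filter_upwards [ae_eventually_notMem hsum] with ω hω
    filter_upwards [hω] with n hn
    by_contra! hlt
    exact hn (pow_le_pow_of_le_one (by norm_num) (by norm_num) hlt.le)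
  filter_upwards [ae_all_iff.mpr hK] with ω hω
  exact tendsto_atTop.mpr hω

lemma ae_mem_steps {Ω : Type*} [MeasurableSpace Ω] {P : Measure Ω} {g : ℕ → Ω → PSL2Z}
    (hmeas : ∀ i, Measurable (g i)) (hlaw : ∀ i, P.map (g i) = stepMeasure) :
    ∀ᵐ ω ∂P, ∀ i, g i ω = b * a ∨ g i ω = a * b := by
  refine ae_all_iff.mpr fun i => ?_
  refine ae_of_ae_map (p := fun x => x = b * a ∨ x = a * b) (hmeas i).aemeasurable ?_
  rw [hlaw, stepMeasure, ae_add_measure_iff]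
  constructor <;> refine Measure.ae_smul_measure ?_ _ <;> simp [ae_dirac_eq]

lemma getElem?_eq_of_suffix_reverse {l m : List Letter} (h : l.reverse.drop 2 <:+ m.reverse)
    {i : ℕ} (hi : i + 2 < l.length) : m[i]? = l[i]? := by
  rw [List.drop_reverse, List.reverse_suffix] at h
  have hi' : i < l.length - 2 := by omega
  obtain ⟨t, rfl⟩ := h
  rw [List.getElem?_append_left (by simp; omega), List.getElem?_take_of_lt hi']

/-- Once the words have grown, their initial letters do not change any more. -/
lemma eventually_getElem?_eq {Ω : Type*} {g : ℕ → Ω → PSL2Z} {ω : Ω}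
    (hstep : ∀ i, g i ω = b * a ∨ g i ω = a * b)
    (hheight : Tendsto (fun n => height (revWord (walk g n ω))) atTop atTop) (i : ℕ) :
    ∃ x : Letter, ∀ᶠ n in atTop, (canonicalWord (walk g n ω))[i]? = some x := by
  -- Height is at most twice the length, so from time N on the length is at least i + 3 and letter i
  -- lies outside the last two.
  obtain ⟨N, hN⟩ := eventually_atTop.mp (hheight.eventually_ge_atTop (2 * (i + 3)))
  have hlen : ∀ n ≥ N, i + 2 < (canonicalWord (walk g n ω)).length := fun n hn => by
    have h1 := hN n hn
    have h2 := height_le (revWord (walk g n ω))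
    rw [revWord, List.length_reverse] at h2
    rw [revWord] at h1
    omega
  have hlt : i < (canonicalWord (walk g N ω)).length := by have := hlen N le_rfl; omega
  refine ⟨(canonicalWord (walk g N ω))[i], eventually_atTop.mpr ⟨N, fun n hn => ?_⟩⟩
  induction n, hn using Nat.le_induction with
  | base => exact List.getElem?_eq_getElem hlt
  | succ n hn ih =>
    rw [← ih]
    refine getElem?_eq_of_suffix_reverse ?_ (hlen n hn)
    change (revWord (walk g n ω)).drop 2 <:+ revWord (walk g n ω * g n ω)
    rcases hstep n with h | h
    · rw [h, revWord_mul_ba]; exact drop_two_suffix_act_act _ _ _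
    · rw [h, revWord_mul_ab]; exact drop_two_suffix_act_act _ _ _

open Classical in
/-- The letter at position `i` that the words of the walk settle at. -/
noncomputable def limitLetter {Ω : Type*} (g : ℕ → Ω → PSL2Z) (ω : Ω) (i : ℕ) : Letter :=
  if ∀ᶠ n in atTop, (canonicalWord (walk g n ω))[i]? = some .b then .b
  else if ∀ᶠ n in atTop, (canonicalWord (walk g n ω))[i]? = some .B then .B else .a

lemma limitLetter_spec {Ω : Type*} {g : ℕ → Ω → PSL2Z} {ω : Ω} {i : ℕ}
    (h : ∃ x : Letter, ∀ᶠ n in atTop, (canonicalWord (walk g n ω))[i]? = some x) :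
    ∀ᶠ n in atTop, (canonicalWord (walk g n ω))[i]? = some (limitLetter g ω i) := by
  unfold limitLetter
  split_ifs with h1 h2
  · exact h1
  · exact h2
  · obtain ⟨x, hx⟩ := h
    cases x
    · exact hx
    · exact absurd hx h1
    · exact absurd hx h2

/-- The limit letter is picked by explicit tests, each a countable combination of events about the
walk. -/
lemma measurable_limitLetter (hmeas : ∀ i, Measurable (g i)) :
    Measurable (limitLetter g) := by
  have hset (i : ℕ) (x : Letter) : MeasurableSet
      {ω | ∀ᶠ n in atTop, (canonicalWord (walk g n ω))[i]? = some x} := by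
    simp only [eventually_atTop, Set.ofPred_exists, Set.ofPred_forall]
    refine .iUnion fun N => .iInter fun n => .iInter fun _ => ?_
    exact measurable_walk hmeas n
      (MeasurableSet.of_discrete (s := {y | (canonicalWord y)[i]? = some x}))
  refine measurable_pi_iff.mpr fun i => ?_
  exact Measurable.ite (hset i _) measurable_const
    (Measurable.ite (hset i _) measurable_const measurable_const)

instance Letter.instDiscreteMeasurableSpace : DiscreteMeasurableSpace Letter :=
  ⟨fun _ => trivial⟩

instance Letter.instFintype : Fintype Letter :=
  ⟨{.a, .b, .B}, fun x => by cases x <;> simp⟩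

/-- The infinite reduced word `abab⋯`. -/
def alternating (i : ℕ) : Letter := if Even i then .a else .b

/-- This word is only the default value of `limitPoint` on a null set, making the limit a boundary
point everywhere. -/
lemma adjacent_alternating (i : ℕ) : Adjacent (alternating i) (alternating (i + 1)) := by
  by_cases h : Even i <;> simp [alternating, Adjacent, Nat.even_add_one, h]

lemma adjacent_of_getElem? {l : List Letter} (hl : Reduced l) {i : ℕ} {x y : Letter}
    (hx : l[i]? = some x) (hy : l[i + 1]? = some y) : Adjacent x y := by
  obtain ⟨hi, rfl⟩ := List.getElem?_eq_some_iff.mp hx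
  obtain ⟨hj, rfl⟩ := List.getElem?_eq_some_iff.mp hy
  exact List.isChain_iff_getElem.mp hl i hj

lemma initial_prefix {ξ : Boundary} {l : List Letter} {k : ℕ}
    (h : ∀ i < k, l[i]? = some (ξ.1 i)) : ξ.initial k <+: l := by
  rw [List.prefix_iff_getElem?]
  intro i hi
  have hi' : i < k := by simpa [Boundary.initial] using hi
  rw [h i hi']
  simp [Boundary.initial]

open Classical in
/-- The limit of the walk, as a boundary point. -/
noncomputable def limitPoint {Ω : Type*} (g : ℕ → Ω → PSL2Z) (ω : Ω) : Boundary :=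
  ⟨if ∀ i, Adjacent (limitLetter g ω i) (limitLetter g ω (i + 1)) then limitLetter g ω
    else alternating, by
      split_ifs with h
      · exact h
      · exact adjacent_alternating⟩

lemma measurable_limitPoint (hmeas : ∀ i, Measurable (g i)) : Measurable (limitPoint g) := by
  have hL := measurable_limitLetter hmeas
  refine Measurable.subtype_mk (Measurable.ite ?_ hL measurable_const)
  simp only [Set.ofPred_forall]
  refine .iInter fun i => ?_
  have h2 : Measurable fun ω => (limitLetter g ω i, limitLetter g ω (i + 1)) :=
    ((measurable_pi_apply i).comp hL).prodMk ((measurable_pi_apply (i + 1)).comp hL)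
  exact h2 (MeasurableSet.of_discrete (s := {p : Letter × Letter | Adjacent p.1 p.2}))

/-- The first letter of a boundary point. -/
def Boundary.first (ξ : Boundary) : Letter := ξ.1 0

lemma measurable_first : Measurable Boundary.first :=
  (measurable_pi_apply 0).comp measurable_subtype_coe

lemma ae_limitPoint (hmeas : ∀ i, Measurable (g i)) (hindep : iIndepFun g P)
    (hlaw : ∀ i, P.map (g i) = stepMeasure) :
    ∀ᵐ ω ∂P, ∀ i, ∀ᶠ n in atTop,
      (canonicalWord (walk g n ω))[i]? = some ((limitPoint g ω).1 i) := by
  filter_upwards [ae_mem_steps hmeas hlaw, ae_tendsto_height hmeas hindep hlaw] with ω h1 h2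
  have h3 : ∀ i, ∀ᶠ n in atTop, (canonicalWord (walk g n ω))[i]? = some (limitLetter g ω i) :=
    fun i => limitLetter_spec (eventually_getElem?_eq h1 h2 i)
  have h4 : ∀ i, Adjacent (limitLetter g ω i) (limitLetter g ω (i + 1)) := fun i => by
    obtain ⟨n, hn, hn'⟩ := ((h3 i).and (h3 (i + 1))).exists
    exact adjacent_of_getElem? (canonicalWord_spec _).1 hn hn'
  simpa only [limitPoint, h4, implies_true, if_true] using h3

lemma ae_convergesTo_limitPoint (hmeas : ∀ i, Measurable (g i)) (hindep : iIndepFun g P)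
    (hlaw : ∀ i, P.map (g i) = stepMeasure) :
    ∀ᵐ ω ∂P, ConvergesTo (fun n => walk g n ω) (limitPoint g ω) := by
  filter_upwards [ae_limitPoint hmeas hindep hlaw] with ω hω k
  have h := (Filter.eventually_all_finset (Finset.range k)).mpr fun i _ => hω i
  filter_upwards [h] with n hn
  exact initial_prefix fun i hi => hn i (Finset.mem_range.mpr hi)

/-! ### The hitting measure -/

lemma cylinder_toPSL (x : Letter) : cylinder x.toPSL = {ξ | ξ.first = x} := by
  have h : canonicalWord x.toPSL = [x] := by
    have := canonicalWord_wordEval [x] (by simp [Reduced])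
    rwa [wordEval_cons, show wordEval [] = 1 from rfl, mul_one] at this
  ext ξ
  simp [cylinder, h, Boundary.initial, Boundary.first]

lemma map_limitPoint_real_cylinder {Ω : Type*} [MeasurableSpace Ω] {P : Measure Ω}
    {g : ℕ → Ω → PSL2Z} (hmeas : ∀ i, Measurable (g i)) (x : Letter) :
    (P.map (limitPoint g)).real (cylinder x.toPSL) =
      ∫ ω, (if (limitPoint g ω).first = x then 1 else 0 : ℝ) ∂P := by
  have hx : MeasurableSet {ξ : Boundary | ξ.first = x} :=
    measurable_first (MeasurableSet.of_discrete (s := {x}))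
  rw [cylinder_toPSL, map_measureReal_apply (measurable_limitPoint hmeas) hx,
    ← integral_indicator_one (measurable_limitPoint hmeas hx)]
  simp [Set.indicator_apply]

/-- The value of a hitting probability from a harmonic function with the right limits. -/
lemma map_limitPoint_real_cylinder_of_harmonic (hmeas : ∀ i, Measurable (g i))
    (hindep : iIndepFun g P) (hlaw : ∀ i, P.map (g i) = stepMeasure) (x : Letter)
    {f : List Letter → ℝ} (hf : ∀ l, Reduced l → avg f l = f l) {φ : ℕ → ℝ}
    (hφ : Tendsto φ atTop (𝓝 0))
    (hlim : ∀ l, |f l - if l.getLast? = some x then 1 else 0| ≤ φ (height l)) :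
    (P.map (limitPoint g)).real (cylinder x.toPSL) = f [] := by
  rw [map_limitPoint_real_cylinder hmeas]
  obtain ⟨C, hC⟩ := hφ.bddAbove_range
  -- The expectation of `f` along the walk is constantly `f []` by harmonicity, and it tends to the
  -- hitting probability by dominated convergence. The bound C + 1 holds because `f` stays within C
  -- of an indicator.
  refine tendsto_nhds_unique (tendsto_integral_of_dominated_convergence
    (F := fun n ω => f (revWord (walk g n ω))) (fun _ => C + 1)
    (fun n => (integrable_walk hmeas hindep hlaw n fun y => f (revWord y)).aestronglyMeasurable)
    (integrable_const _) (fun n => Eventually.of_forall fun ω => ?_) ?_) ?_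
  · have h1 := (hlim (revWord (walk g n ω))).trans (hC ⟨_, rfl⟩)
    rw [Real.norm_eq_abs]
    split_ifs at h1 <;> rw [abs_le] at h1 ⊢ <;> constructor <;> linarith
  · filter_upwards [ae_limitPoint hmeas hindep hlaw, ae_tendsto_height hmeas hindep hlaw]
      with ω h1 h2
    rw [tendsto_iff_norm_sub_tendsto_zero]
    refine squeeze_zero' (Eventually.of_forall fun _ => norm_nonneg _) ?_ (hφ.comp h2)
    filter_upwards [h1 0] with n hn
    -- The last entry of the reversed word is the first letter of the canonical word, which has
    -- settled by time n.
    have h3 : ((limitPoint g ω).first = x) ↔ (revWord (walk g n ω)).getLast? = some x := by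
      rw [revWord, List.getLast?_reverse, List.head?_eq_getElem?, hn, Option.some_inj]
      rfl
    simp only [h3]
    exact hlim (revWord (walk g n ω))
  · simp only [integral_revWord_of_harmonic hmeas hindep hlaw hf]
    exact tendsto_const_nhds

lemma tendsto_popProb_pow : Tendsto (fun n : ℕ => popProb ^ n) atTop (𝓝 0) :=
  tendsto_pow_atTop_nhds_zero_of_lt_one popProb_pos.le popProb_lt_one

lemma map_limitPoint_real_cylinder_a (hmeas : ∀ i, Measurable (g i))
    (hindep : iIndepFun g P) (hlaw : ∀ i, P.map (g i) = stepMeasure) :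
    (P.map (limitPoint g)).real (cylinder a) = 1 / 2 := by
  rw [show a = Letter.a.toPSL from rfl, map_limitPoint_real_cylinder_of_harmonic hmeas hindep hlaw
    Letter.a avg_startA tendsto_popProb_pow]
  · simp [startA]
  · intro l
    have h := pow_pos popProb_pos (height l)
    unfold startA
    split_ifs <;> rw [abs_le] <;> constructor <;> linarith

lemma map_limitPoint_real_cylinder_b (hmeas : ∀ i, Measurable (g i))
    (hindep : iIndepFun g P) (hlaw : ∀ i, P.map (g i) = stepMeasure) :
    (P.map (limitPoint g)).real (cylinder b) = (√5 - 1) / 4 := by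
  rw [show b = Letter.b.toPSL from rfl, map_limitPoint_real_cylinder_of_harmonic hmeas hindep hlaw
    Letter.b avg_startB (φ := fun n => popProb ^ (n - 1))
    (tendsto_popProb_pow.comp (tendsto_sub_atTop_nat 1))]
  · simp [startB, popProb]; ring
  · intro l
    have h := pow_pos popProb_pos (height l + 1)
    have h' : popProb ^ (height l + 1) ≤ popProb ^ (height l - 1) :=
      pow_le_pow_of_le_one popProb_pos.le popProb_lt_one.le (by omega)
    unfold startB
    split_ifs <;> rw [abs_le] <;> constructor <;> linarith

lemma map_limitPoint_real_cylinder_b_inv (hmeas : ∀ i, Measurable (g i))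
    (hindep : iIndepFun g P) (hlaw : ∀ i, P.map (g i) = stepMeasure) :
    (P.map (limitPoint g)).real (cylinder b⁻¹) = (3 - √5) / 4 := by
  have ha := map_limitPoint_real_cylinder_a hmeas hindep hlaw
  have hb := map_limitPoint_real_cylinder_b hmeas hindep hlaw
  have hset (x : Letter) : MeasurableSet {ω | (limitPoint g ω).first = x} :=
    (measurable_first.comp (measurable_limitPoint hmeas))
      (MeasurableSet.of_discrete (s := {x}))
  let u (x : Letter) (ω : Ω) : ℝ := if (limitPoint g ω).first = x then 1 else 0
  have hint (x : Letter) : Integrable (u x) P :=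
    ((integrable_const (1 : ℝ)).indicator (hset x)).congr <|
      Eventually.of_forall fun ω => by simp [u, Set.indicator_apply]
  rw [show a = Letter.a.toPSL from rfl, map_limitPoint_real_cylinder hmeas] at ha
  rw [show b = Letter.b.toPSL from rfl, map_limitPoint_real_cylinder hmeas] at hb
  rw [show b⁻¹ = Letter.B.toPSL from rfl, map_limitPoint_real_cylinder hmeas]
  change ∫ ω, u .a ω ∂P = _ at ha
  change ∫ ω, u .b ω ∂P = _ at hb
  -- The first letter of the limit is exactly one of a, b, b⁻¹, so the third probability is the
  -- complement of the other two.
  have hB : ∫ ω, u .B ω ∂P = ∫ ω, (1 - u .a ω - u .b ω) ∂P := integral_congr_ae <|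
    Eventually.of_forall fun ω => by simp only [u]; cases (limitPoint g ω).first <;> simp
  have h1 := integral_sub ((integrable_const (1 : ℝ)).sub (hint .a)) (hint .b)
  have h2 := integral_sub (integrable_const (1 : ℝ)) (hint .a)
  simp only [Pi.sub_apply, integral_const, probReal_univ, one_smul] at h1 h2
  change ∫ ω, u .B ω ∂P = _
  rw [hB, h1, h2, ha, hb]
  ring

end PSL2Z

theorem mainTheorem8 {Ω : Type*} [MeasurableSpace Ω] (P : Measure Ω) [IsProbabilityMeasure P]
    (g : ℕ → Ω → PSL2Z) (hmeas : ∀ i, Measurable (g i)) (hindep : iIndepFun g P)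
    (hlaw : ∀ i, P.map (g i) = PSL2Z.stepMeasure) :
    -- the drift
    (∀ n, Integrable (fun ω => (PSL2Z.rademacher (PSL2Z.walk g n ω) : ℝ)) P) ∧
    Tendsto (fun n : ℕ => ∫ ω, (PSL2Z.rademacher (PSL2Z.walk g n ω) : ℝ) / (n : ℝ) ∂P) atTop
      (𝓝 ((7 - 3 * √5) / 4)) ∧
    -- the hitting measure on the Gromov boundary
    (∃ wlim : Ω → PSL2Z.Boundary, Measurable wlim ∧
      (∀ᵐ ω ∂P, PSL2Z.ConvergesTo (fun n => PSL2Z.walk g n ω) (wlim ω)) ∧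
      (P.map wlim).real (PSL2Z.cylinder PSL2Z.a) = 1 / 2 ∧
      (P.map wlim).real (PSL2Z.cylinder PSL2Z.b) = (√5 - 1) / 4 ∧
      (P.map wlim).real (PSL2Z.cylinder PSL2Z.b⁻¹) = (3 - √5) / 4) 
:=
  ⟨fun n => PSL2Z.integrable_walk hmeas hindep hlaw n fun x => (PSL2Z.rademacher x : ℝ),
    PSL2Z.tendsto_integral_rademacher_div hmeas hindep hlaw,
    PSL2Z.limitPoint g, PSL2Z.measurable_limitPoint hmeas,
    PSL2Z.ae_convergesTo_limitPoint hmeas hindep hlaw,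
    PSL2Z.map_limitPoint_real_cylinder_a hmeas hindep hlaw,
    PSL2Z.map_limitPoint_real_cylinder_b hmeas hindep hlaw,
    PSL2Z.map_limitPoint_real_cylinder_b_inv hmeas hindep hlaw⟩
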